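/- Let $n\ge 1$ be an integer. For a metric space $X$ let $\dim_H X$ denote its Hausdorff dimension and $\dim_t X$ its (small inductive) topological dimension, with the conventions $\dim_H\emptyset=\dim_t\emptyset=-1$. The inductive topological Hausdorff dimensions are defined by $\dim_{t^kH}\emptyset=-1$ for all integers $k\ge 0$ and, for non-empty $X$, by $\dim_{t^0H}X=\dim_H X$ and, for $k\ge 1$, $$\dim_{t^kH}X=\inf\{d : X \text{ has a basis } \mathcal U \text{ of open sets such that } \dim_{t^{k-1}H}\partial U\le d-1 \text{ for every } U\in\mathcal U\},$$ where $d=\infty$ is allowed and $\infty-1=\infty$. For a compact metric space $K$ let $C_n(K)$ be the space of continuous maps $K\to\mathbb R^n$ with the supremum norm. If $K$ is a compact metric space with $\dim_t K\ge n$, then for the generic $f\in C_n(K)$, that is, for all $f$ in a co-meager subset of $C_n(K)$, $$\sup_{y\in\mathbb R^n}\dim_H f^{-1}(y)=\dim_{t^nH}K-n,$$ where $\infty-n=\infty$. -/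

import Mathlib

open Topology TopologicalSpace

noncomputable section

universe u

open Classical in
/-- The Hausdorff dimension of a subset of a metric space, as an extended real number,
with the convention that the empty set has Hausdorff dimension `-1`. -/
def hausdorffDim {X : Type u} [MetricSpace X] (s : Set X) : EReal :=
  if s = ∅ then -1 else (dimH s : EReal)

open Classical in
/-- The `n`th inductive topological Hausdorff dimension of a metric space. The empty space has
dimension `-1`; for a non-empty space the `0`th dimension is the Hausdorff dimension, and the
`(n+1)`st one is the infimum of all `d` such that `X` has a basis of open sets whose boundaries
(as metric subspaces) have `n`th dimension at most `d - 1`. Here `⊤ - 1 = ⊤`. -/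
def indTopHausdorffDim : ℕ → (X : Type u) → [MetricSpace X] → EReal
  | 0, X, _ => hausdorffDim (Set.univ : Set X)
  | n + 1, X, _ =>
    if IsEmpty X then -1
    else sInf {d : EReal | ∃ B : Set (Set X), IsTopologicalBasis B ∧
      ∀ U ∈ B, indTopHausdorffDim n (frontier U) ≤ d - 1}

end

/-!
Sets of `q`-dimensional Hausdorff content zero are those of Hausdorff measure zero, but content,
unlike measure, is stable under small changes of a compact set. Hence having all fibres of content
`< η` is an open condition on a continuous map, and having them all null is a `G_δ` condition; this
makes Kuratowski–Ulam applicable to `C(K, ℝⁿ⁺¹) ≃ C(K, ℝⁿ) × C(K, ℝ)` and allows induction on `n`.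

Upper bound: let `X` have a basis whose boundaries have dimension less than `q + n`, and let `f`
be a map to `ℝⁿ` with null fibres on countably many of these boundaries. Off a neighbourhood of
finitely many boundaries, `X` splits into small clopen pieces, which a small perturbation `b` of a
given real function sends to distinct values. So a fibre of `(f, b)` is either near the
boundaries, where `f` makes its content small, or inside a single small piece.

Lower bound: some point `x` has a neighbourhood `V` such that all smaller open neighbourhoods of `x`
have boundaries of dimension greater than `q + n`. Adding to a real function a small bump that is
low at `x` shows that the generic `b` has a level set containing the boundary of such a
neighbourhood, and there the generic `f` has a non-null fibre by induction.
-/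

open Set Filter Metric MeasureTheory
open scoped ENNReal NNReal

section HausdorffContent

/-- The `q`-dimensional Hausdorff content: sets are covered by countably many sets of arbitrary
diameter, so that, unlike for `μH[q]`, the content of a set is the infimum of the contents of its
open neighbourhoods when `0 < q`. -/
noncomputable def hausdorffContent {X : Type*} [PseudoEMetricSpace X] (q : ℝ≥0) : OuterMeasure X :=
  OuterMeasure.boundedBy fun s => ediam s ^ (q : ℝ)

section PseudoEMetricSpace

variable {X : Type*} [PseudoEMetricSpace X] {q : ℝ≥0} {s : Set X} {η : ℝ≥0∞}

theorem hausdorffContent_le_ediam_rpow (q : ℝ≥0) (s : Set X) :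
    hausdorffContent q s ≤ ediam s ^ (q : ℝ) :=
  OuterMeasure.boundedBy_le _

theorem exists_cover_of_hausdorffContent_lt (hq : 0 < q) (h : hausdorffContent q s < η) :
    ∃ t : ℕ → Set X, s ⊆ ⋃ k, t k ∧ ∑' k, ediam (t k) ^ (q : ℝ) < η := by
  have ediam_rpow_empty : ediam (∅ : Set X) ^ (q : ℝ) = 0 := by
    rw [ediam_empty, ENNReal.zero_rpow_of_pos (NNReal.coe_pos.2 hq)]
  rw [hausdorffContent, OuterMeasure.boundedBy_eq_ofFunction ediam_rpow_empty,
    OuterMeasure.ofFunction_apply] at h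
  simpa only [iInf_lt_iff, exists_prop] using h

theorem exists_isOpen_superset_ediam_rpow_lt (h : ediam s ^ (q : ℝ) < η) :
    ∃ U, IsOpen U ∧ s ⊆ U ∧ ediam U ^ (q : ℝ) < η := by
  have hcont : Continuous fun δ : ℝ≥0 => (ediam s + 2 * (δ : ℝ≥0∞)) ^ (q : ℝ) :=
    ENNReal.continuous_rpow_const.comp <| continuous_const.add <|
      (ENNReal.continuous_const_mul ENNReal.ofNat_ne_top).comp ENNReal.continuous_coe
  have hlim : ∀ᶠ δ : ℝ≥0 in 𝓝[>] 0, (ediam s + 2 * (δ : ℝ≥0∞)) ^ (q : ℝ) < η :=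
    (hcont.tendsto 0).mono_left nhdsWithin_le_nhds |>.eventually_lt_const (by simpa using h)
  obtain ⟨δ, hδη, hδ⟩ := (hlim.and self_mem_nhdsWithin).exists
  refine ⟨thickening δ s, isOpen_thickening, self_subset_thickening hδ s, hδη.trans_le' ?_⟩
  gcongr
  exact ediam_thickening_le δ

theorem exists_isOpen_superset_hausdorffContent_lt (hq : 0 < q) (h : hausdorffContent q s < η) :
    ∃ U, IsOpen U ∧ s ⊆ U ∧ hausdorffContent q U < η := by
  obtain ⟨t, hst, ht⟩ := exists_cover_of_hausdorffContent_lt hq h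
  obtain ⟨ε, hε, hεη⟩ := ENNReal.exists_pos_sum_of_countable (tsub_pos_of_lt ht).ne' ℕ
  have ediam_rpow_lt (k : ℕ) : ediam (t k) ^ (q : ℝ) < ediam (t k) ^ (q : ℝ) + ε k :=
    ENNReal.lt_add_right ((ENNReal.le_tsum k).trans_lt ht).ne_top
      (ENNReal.coe_pos.2 (hε k)).ne'
  choose U hU htU hUε using fun k => exists_isOpen_superset_ediam_rpow_lt (ediam_rpow_lt k)
  refine ⟨⋃ k, U k, isOpen_iUnion hU, hst.trans (iUnion_mono htU), ?_⟩
  calc hausdorffContent q (⋃ k, U k)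
      ≤ ∑' k, hausdorffContent q (U k) := measure_iUnion_le _
    _ ≤ ∑' k, (ediam (t k) ^ (q : ℝ) + ε k) :=
        ENNReal.tsum_le_tsum fun k => (hausdorffContent_le_ediam_rpow q _).trans (hUε k).le
    _ = ∑' k, ediam (t k) ^ (q : ℝ) + ∑' k, (ε k : ℝ≥0∞) := ENNReal.tsum_add
    _ < ∑' k, ediam (t k) ^ (q : ℝ) + (η - ∑' k, ediam (t k) ^ (q : ℝ)) :=
        ENNReal.add_lt_add_left ht.ne_top hεη
    _ = η := add_tsub_cancel_of_le ht.le

end PseudoEMetricSpace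

variable {X : Type*} [EMetricSpace X] {q : ℝ≥0} {s : Set X}

theorem hausdorffContent_le_hausdorffMeasure [MeasurableSpace X] [BorelSpace X] :
    hausdorffContent q s ≤ μH[q] s := by
  have h := OuterMeasure.le_mkMetric (fun r => r ^ (q : ℝ)) (hausdorffContent (X := X) q) 1 one_pos
    (fun t _ => hausdorffContent_le_ediam_rpow q t) s
  rwa [OuterMeasure.coe_mkMetric] at h

theorem hausdorffMeasure_eq_zero_of_hausdorffContent_eq_zero [MeasurableSpace X] [BorelSpace X]
    (hq : 0 < q) (h : hausdorffContent q s = 0) : μH[q] s = 0 := by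
  have hq' : (0 : ℝ) < q := NNReal.coe_pos.2 hq
  choose t hst ht using fun m : ℕ => exists_cover_of_hausdorffContent_lt (s := s)
    (η := (m : ℝ≥0∞)⁻¹) hq (by simp [h])
  have hlim : Tendsto (fun m : ℕ => (m : ℝ≥0∞)⁻¹) atTop (𝓝 0) := ENNReal.tendsto_inv_nat_nhds_zero
  have hlim_rpow : Tendsto (fun m : ℕ => (m : ℝ≥0∞)⁻¹ ^ (q : ℝ)⁻¹) atTop (𝓝 0) := by
    simpa [ENNReal.zero_rpow_of_pos (inv_pos.2 hq')] using hlim.ennrpow_const (q : ℝ)⁻¹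
  have ediam_le (m k : ℕ) : ediam (t m k) ≤ (m : ℝ≥0∞)⁻¹ ^ (q : ℝ)⁻¹ :=
    (ENNReal.le_rpow_inv_iff hq').2 ((ENNReal.le_tsum k).trans (ht m).le)
  refine le_antisymm ?_ zero_le
  calc μH[q] s ≤ liminf (fun m => ∑' k, ediam (t m k) ^ (q : ℝ)) atTop :=
        Measure.hausdorffMeasure_le_liminf_tsum _ s _ hlim_rpow t (.of_forall ediam_le)
          (.of_forall hst)
    _ ≤ liminf (fun m : ℕ => (m : ℝ≥0∞)⁻¹) atTop :=
        liminf_le_liminf (.of_forall fun m => (ht m).le)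
    _ = 0 := hlim.liminf_eq

theorem hausdorffContent_eq_zero_of_dimH_lt (h : dimH s < q) : hausdorffContent q s = 0 := by
  borelize X
  exact le_antisymm (hausdorffContent_le_hausdorffMeasure.trans (hausdorffMeasure_of_dimH_lt h).le)
    zero_le

theorem dimH_le_of_hausdorffContent_eq_zero (hq : 0 < q) (h : hausdorffContent q s = 0) :
    dimH s ≤ q := by
  borelize X
  refine dimH_le_of_hausdorffMeasure_ne_top ?_
  simp [hausdorffMeasure_eq_zero_of_hausdorffContent_eq_zero hq h]

end HausdorffContent

section KuratowskiUlam

variable {X Y : Type*} [TopologicalSpace X] [TopologicalSpace Y] [SecondCountableTopology Y]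

theorem eventually_residual_dense_section {W : Set (X × Y)} (hW : IsOpen W) (hWd : Dense W) :
    ∀ᶠ x in residual X, Dense {y | (x, y) ∈ W} := by
  have meets_basis : ∀ V ∈ countableBasis Y, ∀ᶠ x in residual X, ∃ y ∈ V, (x, y) ∈ W := by
    intro V hV
    have hVo : IsOpen V := isOpen_of_mem_countableBasis hV
    have hproj : {x | ∃ y ∈ V, (x, y) ∈ W} = Prod.fst '' (W ∩ univ ×ˢ V) := by
      ext x
      simp [and_comm]
    refine residual_of_dense_open (s := {x | ∃ y ∈ V, (x, y) ∈ W}) ?_ ?_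
    · rw [hproj]
      exact isOpenMap_fst _ (hW.inter (isOpen_univ.prod hVo))
    · refine dense_iff_inter_open.2 fun U hU hUne => ?_
      obtain ⟨⟨x, y⟩, ⟨hx, hy⟩, hxy⟩ := hWd.inter_open_nonempty _ (hU.prod hVo)
        (hUne.prod (nonempty_of_mem_countableBasis hV))
      exact ⟨x, hx, y, hy, hxy⟩
  filter_upwards [(eventually_countable_ball (countable_countableBasis Y)).2 meets_basis] with x hx
  exact (isBasis_countableBasis Y).dense_iff.2 fun V hV _ => hx V hV

theorem eventually_residual_curry {p : X × Y → Prop} (h : ∀ᶠ z in residual (X × Y), p z) :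
    ∀ᶠ x in residual X, ∀ᶠ y in residual Y, p (x, y) := by
  obtain ⟨S, hSo, hSd, hSc, hS⟩ := mem_residual_iff.1 h
  have hdense : ∀ᶠ x in residual X, ∀ W ∈ S, Dense {y | (x, y) ∈ W} :=
    (eventually_countable_ball hSc).2 fun W hW =>
      eventually_residual_dense_section (hSo W hW) (hSd W hW)
  filter_upwards [hdense] with x hx
  have hmem : ∀ᶠ y in residual Y, ∀ W ∈ S, (x, y) ∈ W :=
    (eventually_countable_ball hSc).2 fun W hW =>
      residual_of_dense_open ((hSo W hW).preimage (.prodMk_right x)) (hx W hW)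
  filter_upwards [hmem] with y hy using hS (mem_sInter.2 hy)

theorem eventually_residual_uncurry [BaireSpace X] [BaireSpace Y] {p : X × Y → Prop}
    (hp : BaireMeasurableSet {z | p z})
    (h : ∀ᶠ x in residual X, ∀ᶠ y in residual Y, p (x, y)) : ∀ᶠ z in residual (X × Y), p z := by
  obtain ⟨U, hU, hpU⟩ := hp.residualEq_isOpen
  have hUd : Dense U := by
    refine dense_iff_inter_open.2 fun O hO ⟨⟨x₀, y₀⟩, hz⟩ => ?_
    obtain ⟨A, V, hA, hV, hxA, hyV, hAV⟩ := isOpen_prod_iff.1 hO x₀ y₀ hz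
    obtain ⟨x, hxA, hxp, hxU⟩ := (dense_of_mem_residual
      (h.and (eventually_residual_curry hpU))).inter_open_nonempty A hA ⟨x₀, hxA⟩
    obtain ⟨y, hyV, hyp, hyU⟩ := (dense_of_mem_residual
      (hxp.and hxU)).inter_open_nonempty V hV ⟨y₀, hyV⟩
    exact ⟨(x, y), hAV ⟨hxA, hyV⟩, hyU.mp hyp⟩
  filter_upwards [hpU, residual_of_dense_open hU hUd] with z hz hzU using hz.mpr hzU

end KuratowskiUlam

section Fibers

/-- Every fibre of `f` meets `F` in a set of `q`-dimensional Hausdorff content zero. -/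
def FibersNullOn {K E : Type*} [PseudoEMetricSpace K] (q : ℝ≥0) (F : Set K) (f : K → E) : Prop :=
  ∀ y, hausdorffContent q (f ⁻¹' {y} ∩ F) = 0

theorem equiv_comp_preimage_singleton {K E E' : Type*} (e : E ≃ E') (f : K → E) (y : E) :
    e ∘ f ⁻¹' {e y} = f ⁻¹' {y} := by
  rw [preimage_comp, ← image_singleton, e.preimage_image]

variable {K E E' : Type*} [PseudoEMetricSpace K] {q : ℝ≥0} {F F' : Set K} {η : ℝ≥0∞}

theorem FibersNullOn.mono {f : K → E} (h : FibersNullOn q F f) (hF : F' ⊆ F) :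
    FibersNullOn q F' f :=
  fun y => measure_mono_null (inter_subset_inter_right _ hF) (h y)

theorem fibersNullOn_equiv_comp (e : E ≃ E') (f : K → E) :
    FibersNullOn q F (e ∘ f) ↔ FibersNullOn q F f := by
  refine (e.forall_congr fun y => ?_).symm
  rw [equiv_comp_preimage_singleton]

theorem FibersNullOn.of_prodMk {b : K → E} {f : K → E'} {c : E}
    (h : FibersNullOn q F fun x => (b x, f x)) (hb : F ⊆ b ⁻¹' {c}) : FibersNullOn q F f := by
  refine fun y => measure_mono_null ?_ (h (c, y))
  rintro x ⟨hxy, hxF⟩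
  exact ⟨Prod.ext (hb hxF) hxy, hxF⟩

theorem fibersNullOn_iff_of_unique [Unique E] {f : K → E} :
    FibersNullOn q F f ↔ hausdorffContent q F = 0 := by
  have preimage_eq (y : E) : f ⁻¹' {y} = univ := eq_univ_of_forall fun x => Subsingleton.elim _ _
  simp only [FibersNullOn, preimage_eq, univ_inter, forall_const]

theorem fibersNullOn_iff_forall_lt {f : K → E} :
    FibersNullOn q F f ↔
      ∀ m : ℕ, ∀ y, hausdorffContent q (f ⁻¹' {y} ∩ F) < (m + 1 : ℝ≥0∞)⁻¹ := by
  refine ⟨fun h m y => ?_, fun h y => ?_⟩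
  · rw [h y, ENNReal.inv_pos]
    finiteness
  · by_contra hy
    obtain ⟨m, hm⟩ := ENNReal.exists_inv_nat_lt hy
    exact (h m y).not_gt (hm.trans_le' (ENNReal.inv_le_inv.2 le_self_add))

variable [CompactSpace K] [MetricSpace E] {f : C(K, E)}

theorem eventually_thickening_inter_preimage_ball_subset (hF : IsClosed F) {A : Set K}
    (hA : IsOpen A) {y : E} (hfA : f ⁻¹' {y} ∩ F ⊆ A) :
    ∀ᶠ p : ℝ × E in 𝓝 (0, y), thickening p.1 F ∩ f ⁻¹' ball p.2 p.1 ⊆ A := by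
  have near_point : ∀ x ∈ Aᶜ, ∀ᶠ z : (ℝ × E) × K in 𝓝 ((0, y), x),
      z.2 ∉ thickening z.1.1 F ∩ f ⁻¹' ball z.1.2 z.1.1 := by
    intro x hxA
    by_cases hxF : x ∈ F
    · have hxy : 0 < dist (f x) y := dist_pos.2 fun h => hxA (hfA ⟨h, hxF⟩)
      have hlt : ∀ᶠ z : (ℝ × E) × K in 𝓝 ((0, y), x), z.1.1 < dist (f z.2) z.1.2 :=
        ContinuousAt.eventually_lt (by fun_prop) (by fun_prop) hxy
      filter_upwards [hlt] with z hz h using hz.not_gt h.2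
    · have hxF' : ENNReal.ofReal 0 < infEDist x F := by
        rw [ENNReal.ofReal_zero]
        exact (infEDist_pos_iff_notMem_closure).2 (by rwa [hF.closure_eq])
      have hlt : ∀ᶠ z : (ℝ × E) × K in 𝓝 ((0, y), x), ENNReal.ofReal z.1.1 < infEDist z.2 F :=
        ContinuousAt.eventually_lt
          (ENNReal.continuous_ofReal.comp (by fun_prop)).continuousAt
          (continuous_infEDist.comp continuous_snd).continuousAt hxF'
      filter_upwards [hlt] with z hz h using hz.not_gt h.1
  have near_compl : ∀ᶠ p : ℝ × E in 𝓝 (0, y), ∀ x ∈ Aᶜ, x ∉ thickening p.1 F ∩ f ⁻¹' ball p.2 p.1 :=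
    hA.isClosed_compl.isCompact.eventually_forall_of_forall_eventually near_point
  filter_upwards [near_compl] with p hp x hx
  by_contra hxA
  exact hp x hxA hx

theorem exists_pos_forall_hausdorffContent_thickening_lt (hq : 0 < q) (hF : IsClosed F)
    (h : ∀ y, hausdorffContent q (f ⁻¹' {y} ∩ F) < η) :
    ∃ r > 0, ∀ y, hausdorffContent q (thickening r F ∩ f ⁻¹' ball y r) < η := by
  have near_value : ∀ y ∈ range f, ∀ᶠ p : ℝ × E in 𝓝 (0, y),
      hausdorffContent q (thickening p.1 F ∩ f ⁻¹' ball p.2 p.1) < η := by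
    intro y _
    obtain ⟨A, hA, hfA, hAη⟩ := exists_isOpen_superset_hausdorffContent_lt hq (h y)
    filter_upwards [eventually_thickening_inter_preimage_ball_subset hF hA hfA] with p hp
    exact (measure_mono hp).trans_lt hAη
  have uniform : ∀ᶠ r : ℝ in 𝓝[>] 0, ∀ y ∈ range f,
      hausdorffContent q (thickening r F ∩ f ⁻¹' ball y r) < η :=
    ((isCompact_range f.continuous).eventually_forall_of_forall_eventually
      near_value).filter_mono nhdsWithin_le_nhds
  obtain ⟨r, hr, hr0⟩ := (uniform.and self_mem_nhdsWithin).exists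
  refine ⟨r / 2, half_pos hr0, fun y => ?_⟩
  obtain hempty | ⟨x, -, hx⟩ := (thickening (r / 2) F ∩ f ⁻¹' ball y (r / 2)).eq_empty_or_nonempty
  · rw [hempty, measure_empty]
    exact zero_le.trans_lt (h y)
  · have hball : ball y (r / 2) ⊆ ball (f x) r :=
      ball_subset_ball' (by linarith [mem_ball'.1 hx])
    refine (measure_mono ?_).trans_lt (hr (f x) (mem_range_self x))
    exact inter_subset_inter (thickening_mono (half_le_self hr0.le) F) (preimage_mono hball)

theorem isOpen_setOf_forall_hausdorffContent_lt (hq : 0 < q) (hF : IsClosed F) :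
    IsOpen {f : C(K, E) | ∀ y, hausdorffContent q (f ⁻¹' {y} ∩ F) < η} := by
  refine Metric.isOpen_iff.2 fun f hf => ?_
  obtain ⟨r, hr, hrη⟩ := exists_pos_forall_hausdorffContent_thickening_lt hq hF hf
  refine ⟨r, hr, fun g hg y => (measure_mono ?_).trans_lt (hrη y)⟩
  rintro x ⟨rfl, hxF⟩
  exact ⟨self_subset_thickening hr F hxF,
    (ContinuousMap.dist_apply_le_dist x).trans_lt (mem_ball'.1 hg)⟩

theorem baireMeasurableSet_fibersNullOn (hq : 0 < q) (hF : IsClosed F) :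
    BaireMeasurableSet {f : C(K, E) | FibersNullOn q F f} := by
  have hInter : {f : C(K, E) | FibersNullOn q F f} =
      ⋂ m : ℕ, {f : C(K, E) | ∀ y, hausdorffContent q (f ⁻¹' {y} ∩ F) < (m + 1 : ℝ≥0∞)⁻¹} := by
    ext f
    simp only [mem_iInter, mem_ofPred_eq, fibersNullOn_iff_forall_lt]
  rw [hInter]
  exact .iInter fun m => (isOpen_setOf_forall_hausdorffContent_lt hq hF).baireMeasurableSet

end Fibers

section ContinuousMap

variable {K A B : Type*} [TopologicalSpace K] [TopologicalSpace A] [TopologicalSpace B]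

theorem eventually_residual_comp_homeomorph_iff (e : A ≃ₜ B) {p : C(K, B) → Prop} :
    (∀ᶠ f : C(K, A) in residual C(K, A), p ((e : C(A, B)).comp f)) ↔
      ∀ᶠ g in residual C(K, B), p g := by
  rw [← ((Homeomorph.refl K).arrowCongr e).residual_map_eq, eventually_map]
  rfl

/-- The universal property of the product, as a homeomorphism of spaces of continuous maps. -/
def prodMkHomeomorph [LocallyCompactSpace K] : C(K, A) × C(K, B) ≃ₜ C(K, A × B) where
  toFun f := f.1.prodMk f.2
  invFun f := (ContinuousMap.fst.comp f, ContinuousMap.snd.comp f)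
  continuous_toFun := ContinuousMap.continuous_of_continuous_uncurry _ <| by
    change Continuous fun z : (C(K, A) × C(K, B)) × K => (z.1.1 z.2, z.1.2 z.2)
    fun_prop
  continuous_invFun := (ContinuousMap.continuous_postcomp _).prodMk
    (ContinuousMap.continuous_postcomp _)

theorem eventually_residual_prodMk [LocallyCompactSpace K] [BaireSpace C(K, A)]
    [BaireSpace C(K, B)] [SecondCountableTopology C(K, B)] {p : C(K, A × B) → Prop}
    (hp : BaireMeasurableSet {f | p f})
    (h : ∀ᶠ a in residual C(K, A), ∀ᶠ b in residual C(K, B), p (a.prodMk b)) :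
    ∀ᶠ f in residual C(K, A × B), p f := by
  rw [← (prodMkHomeomorph (K := K)).residual_map_eq, eventually_map]
  exact eventually_residual_uncurry
    (hp.preimage prodMkHomeomorph.continuous prodMkHomeomorph.isOpenMap) h

end ContinuousMap

section Perturbation

theorem dense_setOf_injective (ι : Type*) [Finite ι] :
    Dense {c : ι → ℝ | Function.Injective c} := by
  have hInter : {c : ι → ℝ | Function.Injective c} =
      ⋂ p : {p : ι × ι // p.1 ≠ p.2}, {c : ι → ℝ | c p.1.1 - c p.1.2 ≠ 0} := by
    ext c
    simp only [mem_iInter, mem_ofPred_eq, sub_ne_zero, Subtype.forall, Prod.forall]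
    exact ⟨fun hc i j hij => hc.ne hij, fun hc i j => not_imp_not.1 (hc i j)⟩
  rw [hInter]
  refine dense_iInter_of_isOpen
    (fun p => isOpen_ne_fun (by fun_prop) continuous_const) fun ⟨⟨i, j⟩, hij⟩ => ?_
  classical
  have : Fintype ι := Fintype.ofFinite ι
  let φ : (ι → ℝ) →L[ℝ] ℝ := .proj (R := ℝ) (φ := fun _ => ℝ) i - .proj (R := ℝ) (φ := fun _ => ℝ) j
  have hφ : Function.Surjective φ := fun t => ⟨Pi.single i t, by simp [φ, hij]⟩
  exact (dense_compl_singleton (0 : ℝ)).preimage (φ.isOpenMap hφ)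

theorem exists_isLocallyConstant_forall_mem {W ι : Type*} [TopologicalSpace W] [Finite ι]
    {U : ι → Set W} (hU : ∀ j, IsClopen (U j)) (hcov : ∀ w, ∃ j, w ∈ U j) :
    ∃ k : W → ι, IsLocallyConstant k ∧ ∀ w, w ∈ U (k w) := by
  rcases isEmpty_or_nonempty W with _ | ⟨⟨w₀⟩⟩
  · exact ⟨isEmptyElim, .of_constant _ isEmptyElim, isEmptyElim⟩
  have : Nonempty ι := ⟨(hcov w₀).choose⟩
  have mem_locallyConstant : IsLocallyConstant fun w => {j | w ∈ U j} := by
    refine (IsLocallyConstant.iff_eventually_eq _).2 fun w => ?_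
    have mem_iff : ∀ᶠ w' in 𝓝 w, ∀ j, w' ∈ U j ↔ w ∈ U j := by
      refine eventually_all.2 fun j => ?_
      by_cases hw : w ∈ U j
      · filter_upwards [(hU j).isOpen.mem_nhds hw] with w' hw' using iff_of_true hw' hw
      · filter_upwards [(hU j).compl.isOpen.mem_nhds hw] with w' hw' using iff_of_false hw' hw
    filter_upwards [mem_iff] with w' hw' using Set.ext hw'
  exact ⟨_, mem_locallyConstant.comp fun s => Classical.epsilon (· ∈ s),
    fun w => Classical.epsilon_spec (hcov w)⟩

theorem exists_dist_le_two_mul_of_isLocallyConstant {K W ι : Type*} [TopologicalSpace K]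
    [NormalSpace K] [CompactSpace K] [TopologicalSpace W] [Finite ι] {e : W → K}
    (he : IsClosedEmbedding e) (a : C(K, ℝ)) {k : W → ι} (hk : IsLocallyConstant k) {ε : ℝ}
    (hε : 0 < ε) (hosc : ∀ z w, k z = k w → dist (a (e z)) (a (e w)) ≤ ε) :
    ∃ b : C(K, ℝ), dist b a ≤ 2 * ε ∧ ∀ z w, b (e z) = b (e w) → k z = k w := by
  have exists_value : ∀ j, ∃ t : ℝ, ∀ w, k w = j → dist t (a (e w)) ≤ ε := by
    intro j
    by_cases hj : ∃ z, k z = j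
    · obtain ⟨z, rfl⟩ := hj
      exact ⟨a (e z), fun w hw => hosc z w hw.symm⟩
    · exact ⟨0, fun w hw => (hj ⟨w, hw⟩).elim⟩
  choose t ht using exists_value
  have : Fintype ι := Fintype.ofFinite ι
  obtain ⟨c, hct, hc⟩ : ∃ c ∈ ball t ε, Function.Injective c :=
    (dense_setOf_injective ι).inter_open_nonempty _ isOpen_ball (nonempty_ball.2 hε)
  let g : C(W, ℝ) := ⟨fun w => c (k w) - a (e w),
    (hk.comp c).continuous.sub (a.continuous.comp he.continuous)⟩
  have hg : ∀ w, g w ∈ Icc (-(2 * ε)) (2 * ε) := by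
    intro w
    refine abs_le.1 ?_
    rw [ContinuousMap.coe_mk, ← Real.dist_eq]
    calc dist (c (k w)) (a (e w)) ≤ dist (c (k w)) (t (k w)) + dist (t (k w)) (a (e w)) :=
          dist_triangle _ _ _
      _ ≤ ε + ε := add_le_add ((dist_le_pi_dist c t _).trans (mem_ball.1 hct).le) (ht _ w rfl)
      _ = 2 * ε := (two_mul ε).symm
  obtain ⟨G, hG, hGg⟩ := g.exists_extension_forall_mem_of_isClosedEmbedding hg
    (nonempty_Icc.2 (by linarith)) he
  have hb : ∀ w, (a + G) (e w) = c (k w) := by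
    intro w
    have hGw : G (e w) = c (k w) - a (e w) := congr_fun hGg w
    rw [ContinuousMap.add_apply, hGw, add_sub_cancel]
  refine ⟨a + G, ?_, fun z w h => hc (by rwa [hb, hb] at h)⟩
  refine (ContinuousMap.dist_le (by positivity)).2 fun x => ?_
  rw [ContinuousMap.add_apply, dist_self_add_left, Real.norm_eq_abs]
  exact abs_le.2 (hG x)

theorem exists_finite_subset_basis_forall_of_smallSets {X : Type*} [TopologicalSpace X]
    [CompactSpace X] {B : Set (Set X)} (hB : IsTopologicalBasis B) {p : Set X → Prop}
    (hp : ∀ x, ∀ᶠ U in (𝓝 x).smallSets, p U) :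
    ∃ T ⊆ B, T.Finite ∧ (∀ x, ∃ U ∈ T, x ∈ U) ∧ ∀ U ∈ T, p U := by
  have exists_basis_set : ∀ x, ∃ U ∈ B, x ∈ U ∧ p U := by
    intro x
    obtain ⟨V, hV, hVp⟩ := eventually_smallSets.1 (hp x)
    obtain ⟨U, hU, hxU, hUV⟩ := hB.mem_nhds_iff.1 hV
    exact ⟨U, hU, hxU, hVp U hUV⟩
  choose U hUB hxU hUp using exists_basis_set
  obtain ⟨t, ht⟩ := CompactSpace.elim_nhds_subcover U
    fun x => (hB.isOpen (hUB x)).mem_nhds (hxU x)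
  refine ⟨U '' t, image_subset_iff.2 fun x _ => hUB x, t.finite_toSet.image U, fun x => ?_,
    forall_mem_image.2 fun x _ => hUp x⟩
  have hx : x ∈ ⋃ y ∈ t, U y := ht ▸ mem_univ x
  simpa using hx

theorem eventually_smallSets_ediam_image_le {X Y : Type*} [TopologicalSpace X]
    [PseudoEMetricSpace Y] {g : X → Y} {x : X} (hg : ContinuousAt g x) {δ : ℝ≥0∞} (hδ : 0 < δ) :
    ∀ᶠ U in (𝓝 x).smallSets, ediam (g '' U) ≤ δ := by
  refine eventually_smallSets.2 ⟨_, hg (closedEBall_mem_nhds (g x) (ENNReal.half_pos hδ.ne')),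
    fun U hU => ?_⟩
  calc ediam (g '' U) ≤ ediam (closedEBall (g x) (δ / 2)) := ediam_mono (image_subset_iff.2 hU)
    _ ≤ 2 * (δ / 2) := ediam_closedEBall_le
    _ = δ := ENNReal.mul_div_cancel two_ne_zero ENNReal.ofNat_ne_top

variable {X K E : Type*} [MetricSpace X] [CompactSpace X] [MetricSpace K] [CompactSpace K]
  [MetricSpace E] {B : Set (Set X)} {i : X → K} {q : ℝ≥0}

theorem exists_finite_forall_isOpen_exists_ediam_fiber_le (hB : IsTopologicalBasis B)
    (hi : Isometry i) (a : C(K, ℝ)) {ε : ℝ} (hε : 0 < ε) {δ : ℝ≥0∞} (hδ : 0 < δ) :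
    ∃ T ⊆ B, T.Finite ∧ ∀ N : Set K, IsOpen N → (∀ U ∈ T, i '' frontier U ⊆ N) →
      ∃ b : C(K, ℝ), dist b a ≤ ε ∧ ∀ s, ediam (b ⁻¹' {s} ∩ (range i \ N)) ≤ δ := by
  have small_sets (x : X) : ∀ᶠ U in (𝓝 x).smallSets,
      ediam (id '' U) ≤ δ ∧ ediam ((a ∘ i) '' U) ≤ ENNReal.ofReal (ε / 2) :=
    (eventually_smallSets_ediam_image_le continuousAt_id hδ).and <|
      eventually_smallSets_ediam_image_le (a.continuous.comp hi.continuous).continuousAt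
        (ENNReal.ofReal_pos.2 (half_pos hε))
  simp only [image_id] at small_sets
  obtain ⟨T, hTB, hTfin, hTcov, hT⟩ :=
    exists_finite_subset_basis_forall_of_smallSets hB small_sets
  have hsmall : ∀ U ∈ T, ediam U ≤ δ := fun U hU => (hT U hU).1
  have hosc : ∀ U ∈ T, ∀ z ∈ U, ∀ w ∈ U, dist (a (i z)) (a (i w)) ≤ ε / 2 := fun U hU z hz w hw =>
    (edist_le_ofReal (half_pos hε).le).1 <|
      (edist_le_ediam_of_mem (mem_image_of_mem _ hz) (mem_image_of_mem _ hw)).trans (hT U hU).2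
  refine ⟨T, hTB, hTfin, fun N hN hTN => ?_⟩
  have : Finite T := hTfin
  let W : Set X := (i ⁻¹' N)ᶜ
  have hclopen : ∀ U : T, IsClopen ((↑) ⁻¹' (U : Set X) : Set W) := fun U =>
    isClopen_preimage_val (hB.isOpen (hTB U.2))
      (disjoint_compl_right_iff_subset.2 (image_subset_iff.1 (hTN U U.2)))
  obtain ⟨k, hk, hkmem⟩ := exists_isLocallyConstant_forall_mem hclopen fun w => by
    simpa using hTcov w
  have he : IsClosedEmbedding fun w : W => i w := hi.isClosedEmbedding.comp
    (hN.preimage hi.continuous).isClosed_compl.isClosedEmbedding_subtypeVal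
  obtain ⟨b, hba, hb⟩ := exists_dist_le_two_mul_of_isLocallyConstant he a hk (half_pos hε)
    fun z w hzw => hosc _ (k z).2 _ (hkmem z) _ (hzw ▸ hkmem w)
  refine ⟨b, hba.trans_eq (mul_div_cancel₀ ε two_ne_zero), fun s => ediam_le ?_⟩
  rintro _ ⟨hxs, ⟨x, rfl⟩, hxN⟩ _ ⟨hys, ⟨y, rfl⟩, hyN⟩
  have hxy : k ⟨x, hxN⟩ = k ⟨y, hyN⟩ := hb ⟨x, hxN⟩ ⟨y, hyN⟩ (hxs.trans hys.symm)
  have hx : x ∈ (k ⟨x, hxN⟩ : Set X) := hkmem ⟨x, hxN⟩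
  have hy : y ∈ (k ⟨x, hxN⟩ : Set X) := hxy ▸ hkmem ⟨y, hyN⟩
  rw [hi.edist_eq]
  exact (edist_le_ediam_of_mem hx hy).trans (hsmall _ (k _).2)

theorem exists_dist_le_forall_hausdorffContent_prodMk_lt (hq : 0 < q) (hB : IsTopologicalBasis B)
    (hi : Isometry i) {f : C(K, E)} (hf : ∀ U ∈ B, FibersNullOn q (i '' frontier U) f)
    (a : C(K, ℝ)) {ε : ℝ} (hε : 0 < ε) {η : ℝ≥0∞} (hη : 0 < η) (hη' : η ≠ ⊤) :
    ∃ b : C(K, ℝ), dist b a ≤ ε ∧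
      ∀ p : E × ℝ, hausdorffContent q ((f.prodMk b) ⁻¹' {p} ∩ range i) < η := by
  have hη2 : 0 < η / 2 := ENNReal.half_pos hη.ne'
  obtain ⟨T, hTB, hTfin, hT⟩ := exists_finite_forall_isOpen_exists_ediam_fiber_le hB hi a hε
    (δ := (η / 2) ^ (q : ℝ)⁻¹) (ENNReal.rpow_pos_of_nonneg hη2 (by positivity))
  let F : Set K := ⋃ U ∈ T, i '' frontier U
  have hF : IsClosed F := hTfin.isClosed_biUnion fun U _ =>
    (isClosed_frontier.isCompact.image hi.continuous).isClosed
  have content_fiber_lt : ∀ y, hausdorffContent q (f ⁻¹' {y} ∩ F) < η / 2 := by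
    intro y
    rw [inter_iUnion₂, (measure_biUnion_null_iff hTfin.countable).2 fun U hU => hf U (hTB hU) y]
    exact hη2
  obtain ⟨r, hr, hrη⟩ := exists_pos_forall_hausdorffContent_thickening_lt hq hF content_fiber_lt
  obtain ⟨b, hba, hb⟩ := hT (thickening r F) isOpen_thickening fun U hU =>
    (subset_biUnion_of_mem hU).trans (self_subset_thickening hr F)
  refine ⟨b, hba, fun ⟨y, s⟩ => ?_⟩
  have hcover : (f.prodMk b) ⁻¹' {(y, s)} ∩ range i ⊆
      (thickening r F ∩ f ⁻¹' ball y r) ∪ (b ⁻¹' {s} ∩ (range i \ thickening r F)) := by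
    rintro x ⟨hx, hxi⟩
    obtain ⟨rfl, rfl⟩ := Prod.ext_iff.1 hx
    by_cases hxN : x ∈ thickening r F
    · exact .inl ⟨hxN, mem_ball_self hr⟩
    · exact .inr ⟨rfl, hxi, hxN⟩
  have hb_content : hausdorffContent q (b ⁻¹' {s} ∩ (range i \ thickening r F)) ≤ η / 2 :=
    (hausdorffContent_le_ediam_rpow q _).trans <| (ENNReal.le_rpow_inv_iff (NNReal.coe_pos.2 hq)).1
      (hb s)
  calc hausdorffContent q ((f.prodMk b) ⁻¹' {(y, s)} ∩ range i)
      ≤ hausdorffContent q (thickening r F ∩ f ⁻¹' ball y r) +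
          hausdorffContent q (b ⁻¹' {s} ∩ (range i \ thickening r F)) :=
        (measure_mono hcover).trans (measure_union_le _ _)
    _ < η / 2 + η / 2 := ENNReal.add_lt_add_of_lt_of_le
        (ne_top_of_le_ne_top (ENNReal.div_ne_top hη' two_ne_zero) hb_content) (hrη y) hb_content
    _ = η := ENNReal.add_halves η

theorem eventually_residual_fibersNullOn_prodMk (hq : 0 < q)
    (hB : IsTopologicalBasis B) (hi : Isometry i) {f : C(K, E)}
    (hf : ∀ U ∈ B, FibersNullOn q (i '' frontier U) f) :
    ∀ᶠ b in residual C(K, ℝ), FibersNullOn q (range i) (f.prodMk b) := by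
  simp only [fibersNullOn_iff_forall_lt, eventually_countable_forall]
  intro m
  have hrange : IsClosed (range i) := (isCompact_range hi.continuous).isClosed
  have hopen : IsOpen {b : C(K, ℝ) | ∀ p : E × ℝ,
      hausdorffContent q ((f.prodMk b) ⁻¹' {p} ∩ range i) < (m + 1 : ℝ≥0∞)⁻¹} :=
    (isOpen_setOf_forall_hausdorffContent_lt (E := E × ℝ) hq hrange).preimage
      (f := fun b : C(K, ℝ) => f.prodMk b) (prodMkHomeomorph.continuous.comp (.prodMk_right f))
  refine residual_of_dense_open hopen (Metric.dense_iff.2 fun a ε hε => ?_)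
  obtain ⟨b, hba, hb⟩ := exists_dist_le_forall_hausdorffContent_prodMk_lt hq hB hi hf a
    (half_pos hε) (η := (m + 1 : ℝ≥0∞)⁻¹) (ENNReal.inv_pos.2 (by finiteness))
    (ENNReal.inv_ne_top.2 (by positivity))
  exact ⟨b, hba.trans_lt (half_lt_self hε), hb⟩

end Perturbation

section LevelSet

variable {K : Type*} [TopologicalSpace K]

theorem frontier_inter_setOf_lt_subset_preimage {W : Set K} {b : K → ℝ} (hb : Continuous b) {c : ℝ}
    (hbW : ∀ z ∈ frontier W, c < b z) : frontier (W ∩ {z | b z < c}) ⊆ b ⁻¹' {c} := by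
  intro z hz
  rcases frontier_inter_subset _ _ hz with ⟨hzW, hzb⟩ | ⟨-, hzb⟩
  · exact absurd (closure_lt_subset_le hb continuous_const hzb) (hbW z hzW).not_ge
  · exact frontier_lt_subset_eq hb continuous_const hzb

theorem exists_dist_le_forall_mem_frontier_lt [CompactSpace K] [T2Space K] {x : K} {V : Set K}
    (hV : V ∈ 𝓝 x) (a : C(K, ℝ)) {ε : ℝ} (hε : 0 < ε) :
    ∃ b : C(K, ℝ), dist b a ≤ ε ∧ ∃ W, IsOpen W ∧ x ∈ W ∧ W ⊆ V ∧
      ∃ c, b x < c ∧ ∀ z ∈ frontier W, c < b z := by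
  let W : Set K := interior V ∩ {z | a x - ε / 2 < a z}
  have hW : IsOpen W := isOpen_interior.inter (isOpen_lt continuous_const a.continuous)
  have hxW : x ∈ W := ⟨mem_interior_iff_mem_nhds.2 hV, by simpa using hε⟩
  obtain ⟨u, hux, huW, hu⟩ := exists_continuous_zero_one_of_isClosed isClosed_singleton
    hW.isClosed_compl (disjoint_compl_right_iff_subset.2 (singleton_subset_iff.2 hxW))
  refine ⟨a + ε • u, ?_, W, hW, hxW, inter_subset_left.trans interior_subset, a x + ε / 4, ?_, ?_⟩
  · refine (ContinuousMap.dist_le hε.le).2 fun z => ?_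
    calc dist ((a + ε • u) z) (a z) = ε * u z := by
          simp [abs_of_pos hε, abs_of_nonneg (hu z).1]
      _ ≤ ε := mul_le_of_le_one_right hε.le (hu z).2
  · have hx : u x = 0 := hux rfl
    simpa [hx] using hε
  · intro z hz
    have huz : u z = 1 := huW fun hzW => hz.2 (hW.interior_eq.symm ▸ hzW)
    have haz : a x - ε / 2 ≤ a z := closure_lt_subset_le continuous_const a.continuous
      (closure_mono inter_subset_right hz.1)
    simp only [ContinuousMap.add_apply, ContinuousMap.smul_apply, huz, smul_eq_mul, mul_one]
    linarith

theorem eventually_residual_exists_frontier_subset_preimage [CompactSpace K] [T2Space K] {x : K}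
    {V : Set K} (hV : V ∈ 𝓝 x) :
    ∀ᶠ b : C(K, ℝ) in residual C(K, ℝ),
      ∃ U, IsOpen U ∧ x ∈ U ∧ U ⊆ V ∧ ∃ c, frontier U ⊆ b ⁻¹' {c} := by
  let G : Set C(K, ℝ) := {b | ∃ W, IsOpen W ∧ x ∈ W ∧ W ⊆ V ∧
    ∃ c, b x < c ∧ ∀ z ∈ frontier W, c < b z}
  have hG : IsOpen G := by
    have hUnion : G = ⋃ (W : Set K) (_ : IsOpen W ∧ x ∈ W ∧ W ⊆ V) (c : ℝ),
        {b : C(K, ℝ) | b x < c} ∩ {b | MapsTo b (frontier W) (Ioi c)} := by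
      ext b
      simp [G, MapsTo, and_assoc]
    rw [hUnion]
    exact isOpen_iUnion fun W => isOpen_iUnion fun _ => isOpen_iUnion fun c =>
      (isOpen_lt (continuous_eval_const x) continuous_const).inter
        (ContinuousMap.isOpen_setOfPred_mapsTo isClosed_frontier.isCompact isOpen_Ioi)
  have hGd : Dense G := Metric.dense_iff.2 fun a ε hε =>
    let ⟨b, hba, hb⟩ := exists_dist_le_forall_mem_frontier_lt hV a (half_pos hε)
    ⟨b, hba.trans_lt (half_lt_self hε), hb⟩
  filter_upwards [residual_of_dense_open hG hGd] with b ⟨W, hW, hxW, hWV, c, hxc, hbW⟩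
  exact ⟨W ∩ {z | b z < c}, hW.inter (isOpen_lt b.continuous continuous_const), ⟨hxW, hxc⟩,
    inter_subset_left.trans hWV, c, frontier_inter_setOf_lt_subset_preimage b.continuous hbW⟩

end LevelSet

section Dimension

theorem hausdorffDim_empty {X : Type*} [MetricSpace X] : hausdorffDim (∅ : Set X) = -1 :=
  if_pos rfl

variable {X : Type*} [MetricSpace X] {n : ℕ} {r : EReal}

theorem hausdorffDim_of_nonempty {s : Set X} (h : s.Nonempty) : hausdorffDim s = (dimH s : EReal) :=
  if_neg h.ne_empty

theorem iSup_hausdorffDim_preimage_singleton [Nonempty X] {Y : Type*} (f : X → Y) :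
    ⨆ y, hausdorffDim (f ⁻¹' {y}) = ((⨆ y, dimH (f ⁻¹' {y}) : ℝ≥0∞) : EReal) := by
  have : Nonempty Y := .map f ‹_›
  rw [Monotone.map_ciSup_of_continuousAt (f := ((↑) : ℝ≥0∞ → EReal))
    continuous_coe_ennreal_ereal.continuousAt EReal.coe_ennreal_strictMono.monotone]
  refine le_antisymm (iSup_mono fun y => ?_) (iSup_le fun y => ?_)
  · obtain hy | hy := (f ⁻¹' {y}).eq_empty_or_nonempty
    · rw [hy, hausdorffDim_empty, dimH_empty]
      simp
    · rw [hausdorffDim_of_nonempty hy]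
  · obtain hy | hy := (f ⁻¹' {y}).eq_empty_or_nonempty
    · obtain ⟨x⟩ := ‹Nonempty X›
      refine le_iSup_of_le (f x) ?_
      rw [hausdorffDim_of_nonempty (s := f ⁻¹' {f x}) ⟨x, rfl⟩, hy, dimH_empty]
      exact EReal.coe_ennreal_nonneg _
    · exact le_iSup_of_le y (hausdorffDim_of_nonempty hy).ge

theorem indTopHausdorffDim_of_isEmpty [h : IsEmpty X] (n : ℕ) : indTopHausdorffDim n X = -1 := by
  cases n with
  | zero => rw [indTopHausdorffDim, univ_eq_empty_iff.2 h, hausdorffDim_empty]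
  | succ n => rw [indTopHausdorffDim, if_pos h]

theorem nonempty_of_indTopHausdorffDim_nonneg (h : 0 ≤ indTopHausdorffDim n X) : Nonempty X := by
  by_contra hX
  rw [not_nonempty_iff] at hX
  rw [indTopHausdorffDim_of_isEmpty] at h
  exact h.not_gt (by simp)

theorem indTopHausdorffDim_zero_of_nonempty [Nonempty X] :
    indTopHausdorffDim 0 X = (dimH (univ : Set X) : EReal) := by
  rw [indTopHausdorffDim, hausdorffDim_of_nonempty univ_nonempty]

theorem indTopHausdorffDim_succ_of_nonempty [Nonempty X] (n : ℕ) :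
    indTopHausdorffDim (n + 1) X = sInf {d : EReal | ∃ B : Set (Set X), IsTopologicalBasis B ∧
      ∀ U ∈ B, indTopHausdorffDim n (frontier U) ≤ d - 1} := by
  rw [indTopHausdorffDim, if_neg (not_isEmpty_of_nonempty X)]

theorem exists_isTopologicalBasis_of_indTopHausdorffDim_succ_lt
    (h : indTopHausdorffDim (n + 1) X < r + 1) :
    ∃ B : Set (Set X), IsTopologicalBasis B ∧ ∀ U ∈ B, indTopHausdorffDim n (frontier U) < r := by
  rcases isEmpty_or_nonempty X with hX | hX
  · exact ⟨∅, isTopologicalBasis_of_isOpen_of_nhds (by simp) isEmptyElim, by simp⟩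
  rw [indTopHausdorffDim_succ_of_nonempty, sInf_lt_iff] at h
  obtain ⟨d, ⟨B, hB, hBd⟩, hd⟩ := h
  have hd_sub : d - 1 < r := by
    rwa [← Nat.cast_one, EReal.sub_lt_iff (.inl (EReal.natCast_ne_bot 1))
      (.inl (EReal.natCast_ne_top 1)), Nat.cast_one]
  exact ⟨B, hB, fun U hU => (hBd U hU).trans_lt hd_sub⟩

theorem exists_nhds_of_lt_indTopHausdorffDim_succ [Nonempty X]
    (h : r + 1 < indTopHausdorffDim (n + 1) X) :
    ∃ x : X, ∃ V ∈ 𝓝 x, ∀ U, IsOpen U → x ∈ U → U ⊆ V → r < indTopHausdorffDim n (frontier U) := by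
  contrapose! h
  have hB : IsTopologicalBasis {U : Set X | IsOpen U ∧ indTopHausdorffDim n (frontier U) ≤ r} := by
    refine isTopologicalBasis_of_isOpen_of_nhds (fun U hU => hU.1) fun x V hxV hV => ?_
    obtain ⟨U, hU, hxU, hUV, hUr⟩ := h x V (hV.mem_nhds hxV)
    exact ⟨U, ⟨hU, hUr⟩, hxU, hUV⟩
  rw [indTopHausdorffDim_succ_of_nonempty]
  exact sInf_le ⟨_, hB, fun U hU => hU.2.trans_eq (EReal.add_sub_cancel_right (b := 1)).symm⟩

theorem hasSmallInductiveDimensionLT_of_indTopHausdorffDim_lt (n : ℕ) (X : Type*) [MetricSpace X]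
    (h : indTopHausdorffDim n X < n) : HasSmallInductiveDimensionLT X n := by
  induction n generalizing X with
  | zero =>
    rw [hasSmallInductiveDimensionLT_zero_iff]
    by_contra hX
    rw [not_isEmpty_iff] at hX
    rw [indTopHausdorffDim_zero_of_nonempty, Nat.cast_zero] at h
    exact h.not_ge (EReal.coe_ennreal_nonneg _)
  | succ n ih =>
    rw [Nat.cast_succ] at h
    obtain ⟨B, hB, hBn⟩ := exists_isTopologicalBasis_of_indTopHausdorffDim_succ_lt h
    exact .succ n B hB fun U hU => ih (frontier U) (hBn U hU)

theorem natCast_le_indTopHausdorffDim (h : (n : WithBot ℕ∞) ≤ smallInductiveDimension X) :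
    (n : EReal) ≤ indTopHausdorffDim n X := by
  contrapose! h
  exact smallInductiveDimension_lt_iff.2
    (hasSmallInductiveDimensionLT_of_indTopHausdorffDim_lt n X h)

end Dimension

section GenericFibers

theorem eventually_eq_of_forall_lt_of_forall_gt {α β : Type*} [CompleteLinearOrder α]
    [DenselyOrdered α] [TopologicalSpace α] [FirstCountableTopology α] [OrderTopology α]
    {l : Filter β} [CountableInterFilter l] {φ : β → α} {c : α}
    (hle : ∀ q > c, ∀ᶠ x in l, φ x ≤ q) (hge : ∀ q < c, ∀ᶠ x in l, q ≤ φ x) :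
    ∀ᶠ x in l, φ x = c := by
  filter_upwards [eventually_le_limsup (f := l) (u := φ), eventually_liminf_le (f := l) (u := φ)]
    with x hx_limsup hx_liminf
  refine le_antisymm (hx_limsup.trans ?_) (hx_liminf.trans' ?_)
  · exact le_of_forall_gt_imp_ge_of_dense fun q hq => limsup_le_of_le (h := hle q hq)
  · exact le_of_forall_lt_imp_le_of_dense fun q hq => le_liminf_of_le (h := hge q hq)

variable {K : Type*} {q : ℝ≥0}

theorem iSup_dimH_preimage_singleton_le [EMetricSpace K] {E : Type*} {f : K → E}
    (hq : 0 < q) (h : FibersNullOn q univ f) : ⨆ y, dimH (f ⁻¹' {y}) ≤ q :=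
  iSup_le fun y => dimH_le_of_hausdorffContent_eq_zero hq (by simpa using h y)

theorem le_iSup_dimH_preimage_singleton [EMetricSpace K] {E : Type*} {f : K → E}
    (h : ¬ FibersNullOn q univ f) : q ≤ ⨆ y, dimH (f ⁻¹' {y}) := by
  contrapose! h
  intro y
  rw [inter_univ]
  exact hausdorffContent_eq_zero_of_dimH_lt ((le_iSup (fun y => dimH (f ⁻¹' {y})) y).trans_lt h)

variable [MetricSpace K] [CompactSpace K]

-- The induction on `n` passes from `X` to its frontiers; keeping `X` embedded in a fixed `K` lets
-- it use functions on `K` throughout.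
theorem eventually_residual_fibersNullOn (hq : 0 < q) (n : ℕ) (X : Type u) [MetricSpace X]
    [CompactSpace X] {i : X → K} (hi : Isometry i)
    (h : indTopHausdorffDim n X < ((q : ℝ≥0∞) : EReal) + n) :
    ∀ᶠ f : C(K, Fin n → ℝ) in residual C(K, Fin n → ℝ), FibersNullOn q (range i) f := by
  induction n generalizing X with
  | zero =>
    refine .of_forall fun f => fibersNullOn_iff_of_unique.2 ?_
    refine hausdorffContent_eq_zero_of_dimH_lt ?_
    rw [← image_univ, hi.dimH_image]
    rcases isEmpty_or_nonempty X with hX | hX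
    · rw [univ_eq_empty_iff.2 hX, dimH_empty]
      exact ENNReal.coe_pos.2 hq
    · rwa [indTopHausdorffDim_zero_of_nonempty, Nat.cast_zero, add_zero,
        EReal.coe_ennreal_lt_coe_ennreal_iff] at h
  | succ n ih =>
    rw [Nat.cast_succ, ← add_assoc] at h
    obtain ⟨B, hB, hBn⟩ := exists_isTopologicalBasis_of_indTopHausdorffDim_succ_lt h
    obtain ⟨S, hSB, hSc, hS⟩ := hB.exists_countable
    have null_on_frontiers : ∀ᶠ f : C(K, Fin n → ℝ) in residual C(K, Fin n → ℝ),
        ∀ U ∈ S, FibersNullOn q (i '' frontier U) f := by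
      refine (eventually_countable_ball hSc).2 fun U hU => ?_
      have : CompactSpace (frontier U) := isCompact_iff_compactSpace.1 isClosed_frontier.isCompact
      have h_frontier := ih (frontier U) (hi.comp isometry_subtype_coe) (hBn U (hSB hU))
      rwa [range_comp, Subtype.range_coe] at h_frontier
    have null_prodMk : ∀ᶠ f : C(K, (Fin n → ℝ) × ℝ) in residual C(K, (Fin n → ℝ) × ℝ),
        FibersNullOn q (range i) f := by
      refine eventually_residual_prodMk
        (baireMeasurableSet_fibersNullOn hq (isCompact_range hi.continuous).isClosed) ?_
      filter_upwards [null_on_frontiers] with f hf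
      exact eventually_residual_fibersNullOn_prodMk hq hS hi hf
    let e : (Fin n → ℝ) × ℝ ≃ₜ (Fin (n + 1) → ℝ) :=
      (Homeomorph.prodComm _ _).trans (Fin.consEquivL ℝ fun _ => ℝ).toHomeomorph
    exact (eventually_residual_comp_homeomorph_iff e).1 <|
      null_prodMk.mono fun f => (fibersNullOn_equiv_comp e.toEquiv f).2

theorem eventually_residual_not_fibersNullOn (hq : 0 < q) (n : ℕ) (X : Type u) [MetricSpace X]
    [CompactSpace X] {i : X → K} (hi : Isometry i)
    (h : ((q : ℝ≥0∞) : EReal) + n < indTopHausdorffDim n X) :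
    ∀ᶠ f : C(K, Fin n → ℝ) in residual C(K, Fin n → ℝ), ¬ FibersNullOn q (range i) f := by
  have nonempty {m : ℕ} {Y : Type u} [MetricSpace Y]
      (hY : ((q : ℝ≥0∞) : EReal) + m < indTopHausdorffDim m Y) : Nonempty Y :=
    nonempty_of_indTopHausdorffDim_nonneg <| hY.le.trans' <|
      add_nonneg (EReal.coe_ennreal_nonneg _) (EReal.coe_ennreal_nonneg m)
  have := nonempty h
  induction n generalizing X with
  | zero =>
    refine .of_forall fun f hf => ?_
    have hdim := dimH_le_of_hausdorffContent_eq_zero hq (fibersNullOn_iff_of_unique.1 hf)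
    rw [← image_univ, hi.dimH_image] at hdim
    rw [indTopHausdorffDim_zero_of_nonempty, Nat.cast_zero, add_zero,
      EReal.coe_ennreal_lt_coe_ennreal_iff] at h
    exact h.not_ge hdim
  | succ n ih =>
    rw [Nat.cast_succ, ← add_assoc] at h
    obtain ⟨x, V, hV, hVn⟩ := exists_nhds_of_lt_indTopHausdorffDim_succ h
    rw [hi.isUniformInducing.isInducing.nhds_eq_comap] at hV
    obtain ⟨V', hV', hVV'⟩ := hV
    have not_null_prodMk : ∀ᶠ f : C(K, ℝ × (Fin n → ℝ)) in residual C(K, ℝ × (Fin n → ℝ)),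
        ¬ FibersNullOn q (range i) f := by
      refine eventually_residual_prodMk
        (baireMeasurableSet_fibersNullOn hq (isCompact_range hi.continuous).isClosed).compl ?_
      filter_upwards [eventually_residual_exists_frontier_subset_preimage hV']
        with b ⟨U, hU, hxU, hUV, c, hUc⟩
      have : CompactSpace (frontier (i ⁻¹' U)) :=
        isCompact_iff_compactSpace.1 isClosed_frontier.isCompact
      have hdim := hVn (i ⁻¹' U) (hU.preimage hi.continuous) hxU ((preimage_mono hUV).trans hVV')
      filter_upwards [ih (frontier (i ⁻¹' U)) (hi.comp isometry_subtype_coe) hdim (nonempty hdim)]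
        with f hf hbf
      refine hf ((hbf.mono (range_comp_subset_range _ _)).of_prodMk (c := c) ?_)
      rintro _ ⟨z, rfl⟩
      exact hUc (hi.continuous.frontier_preimage_subset U z.2)
    let e : ℝ × (Fin n → ℝ) ≃ₜ (Fin (n + 1) → ℝ) := (Fin.consEquivL ℝ fun _ => ℝ).toHomeomorph
    exact (eventually_residual_comp_homeomorph_iff e).1 <|
      not_null_prodMk.mono fun f => mt (fibersNullOn_equiv_comp e.toEquiv f).1

theorem eventually_residual_iSup_dimH_preimage_le (hq : 0 < q) {n : ℕ}
    (h : indTopHausdorffDim n K < ((q : ℝ≥0∞) : EReal) + n) :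
    ∀ᶠ f : C(K, Fin n → ℝ) in residual C(K, Fin n → ℝ), ⨆ y, dimH (f ⁻¹' {y}) ≤ q := by
  filter_upwards [eventually_residual_fibersNullOn hq n K isometry_id h] with f hf
  exact iSup_dimH_preimage_singleton_le hq (range_id ▸ hf)

theorem eventually_residual_le_iSup_dimH_preimage (hq : 0 < q) {n : ℕ}
    (h : ((q : ℝ≥0∞) : EReal) + n < indTopHausdorffDim n K) :
    ∀ᶠ f : C(K, Fin n → ℝ) in residual C(K, Fin n → ℝ), q ≤ ⨆ y, dimH (f ⁻¹' {y}) := by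
  filter_upwards [eventually_residual_not_fibersNullOn hq n K isometry_id h] with f hf
  exact le_iSup_dimH_preimage_singleton (range_id ▸ hf)

variable (K) in
theorem eventually_residual_iSup_dimH_preimage_eq (n : ℕ) :
    ∀ᶠ f : C(K, Fin n → ℝ) in residual C(K, Fin n → ℝ),
      ⨆ y, dimH (f ⁻¹' {y}) = (indTopHausdorffDim n K - n).toENNReal := by
  have h_ne_bot : (n : EReal) ≠ ⊥ := EReal.natCast_ne_bot n
  have h_ne_top : (n : EReal) ≠ ⊤ := EReal.natCast_ne_top n
  refine eventually_eq_of_forall_lt_of_forall_gt (fun q hq => ?_) fun q hq => ?_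
  · cases q with
    | top => exact .of_forall fun f => le_top
    | coe q =>
      refine eventually_residual_iSup_dimH_preimage_le (ENNReal.coe_pos.1 hq.bot_lt) ?_
      rw [← EReal.sub_lt_iff (.inl h_ne_bot) (.inl h_ne_top)]
      rw [gt_iff_lt, ← EReal.coe_ennreal_lt_coe_ennreal_iff, EReal.coe_toENNReal_eq_max] at hq
      exact (le_max_right _ _).trans_lt hq
  · lift q to ℝ≥0 using hq.ne_top
    rcases eq_zero_or_pos q with rfl | hq_pos
    · exact .of_forall fun f => bot_le
    · refine eventually_residual_le_iSup_dimH_preimage hq_pos ?_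
      rw [← EReal.lt_sub_iff_add_lt (.inl h_ne_bot) (.inl h_ne_top)]
      rw [← EReal.coe_ennreal_lt_coe_ennreal_iff, EReal.coe_toENNReal_eq_max] at hq
      exact (lt_max_iff.1 hq).resolve_left (EReal.coe_ennreal_nonneg _).not_gt

end GenericFibers

theorem corollary6p10 {K : Type*} [MetricSpace K] [CompactSpace K] (n : ℕ) (hn : 0 < n)
    (hK : (n : WithBot ℕ∞) ≤ smallInductiveDimension K) :
    ∀ᶠ f : C(K, EuclideanSpace ℝ (Fin n)) in residual C(K, EuclideanSpace ℝ (Fin n)),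
      (⨆ y : EuclideanSpace ℝ (Fin n), hausdorffDim (f ⁻¹' {y}))
        = indTopHausdorffDim n K - (n : EReal) := by
  have hD : (n : EReal) ≤ indTopHausdorffDim n K := natCast_le_indTopHausdorffDim hK
  have : Nonempty K :=
    nonempty_of_indTopHausdorffDim_nonneg ((EReal.coe_ennreal_nonneg n).trans hD)
  let e : (Fin n → ℝ) ≃ₜ EuclideanSpace ℝ (Fin n) :=
    (EuclideanSpace.equiv (Fin n) ℝ).symm.toHomeomorph
  refine (eventually_residual_comp_homeomorph_iff e).1 ?_
  filter_upwards [eventually_residual_iSup_dimH_preimage_eq K n] with f hf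
  have hD_sub : 0 ≤ indTopHausdorffDim n K - n :=
    (EReal.sub_nonneg (.inr (EReal.natCast_ne_top n)) (.inr (EReal.natCast_ne_bot n))).2 hD
  calc ⨆ y, hausdorffDim (e ∘ f ⁻¹' {y})
      = ⨆ y, hausdorffDim (f ⁻¹' {y}) :=
        (e.toEquiv.iSup_congr fun y =>
          congr_arg hausdorffDim (equiv_comp_preimage_singleton e.toEquiv f y)).symm
    _ = ((⨆ y, dimH (f ⁻¹' {y}) : ℝ≥0∞) : EReal) := iSup_hausdorffDim_preimage_singleton f
    _ = indTopHausdorffDim n K - n := by rw [hf, EReal.coe_toENNReal hD_sub]
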